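/- Let $I=[0,1]$ and let $W:I^2\to[0,1]$ be a graphon, i.e. a symmetric Lebesgue measurable function, with $\|W\|_1>0$. Let $\varepsilon_n\in(0,1]$ satisfy $\varepsilon_n=\omega(\log n/n)$, i.e. $\frac{\log n}{n\,\varepsilon_n}\to0$ as $n\to\infty$. For each $n$ let $X_1,\dots,X_n\in I$ be latent variables of one of the following two types (the same type for all $n$): (a) deterministic: $X_i=i/n$, in which case $W$ is additionally assumed to be continuous at almost every point of $I^2$; or (b) stochastic: $X_i=U_{(i)}$, the order statistics of i.i.d. random variables $U_1,\dots,U_n$ uniform in $I$. Let $A^{(n)}$ be the adjacency matrix of the graph on $n$ vertices sampled from $W$: it is symmetric with zero diagonal, and $A^{(n)}_{ij}=\operatorname{sign}(W(X_i,X_j))\,\eta_{ij}$ for $i<j$, where, conditionally on $X_1,\dots,X_n$, the $\eta_{ij}$ ($i<j$) are independent Bernoulli random variables with parameters $\varepsilon_n|W(X_i,X_j)|$. All these variables, for all $n$, live on one probability space; nothing is assumed about the joint law for different $n$. With $I_i=(\frac{i-1}{n},\frac in]$, put $W_n(x,y)=\sum_{i,j}A^{(n)}_{ij}\mathbf 1_{I_i}(x)\mathbf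 1_{I_j}(y)$, $d_{W_n}(x)=\int_I W_n(x,y)\,dy$ and $d_i=\sum_jA^{(n)}_{ij}$. Then, for every $n\ge1$, $\|d_{W_n}\|_\infty=\max_i \frac{d_i}{n}$ is the maximum normalized degree and $\|W_n\|_1=\frac1n\sum_i\frac{d_i}{n}$ is the average normalized degree of the sampled graph, and almost surely, as $n\to\infty$, $$\varepsilon_n^{-1}\|d_{W_n}\|_\infty=\Theta(1)\qquad\text{and}\qquad \varepsilon_n^{-1}\|W_n\|_1=\Theta(1).$$ (Here $f(n)=\Theta(1)$ means that there are constants $c,C>0$ and $N$ with $c\le|f(n)|\le C$ for all $n>N$; almost surely such constants exist.) -/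

import Mathlib

open MeasureTheory ProbabilityTheory Filter Asymptotics
open scoped ENNReal

noncomputable section

/-- A graphon: a symmetric Lebesgue measurable function on the unit square with values
in `[0,1]`. (`NullMeasurable` with respect to `volume` is Lebesgue measurability; every Borel
function qualifies.) -/
structure IsGraphon (W : unitInterval → unitInterval → ℝ) : Prop where
  symm : ∀ x y, W x y = W y x
  measurable : NullMeasurable (Function.uncurry W) (volume : Measure (unitInterval × unitInterval))
  mem_Icc : ∀ x y, W x y ∈ Set.Icc (0 : ℝ) 1

/-- `W` is continuous at almost every point of the unit square. -/
def AEContinuous (W : unitInterval → unitInterval → ℝ) : Prop :=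
  ∀ᵐ z : unitInterval × unitInterval, ContinuousAt (Function.uncurry W) z

/-- The degree function `d_W(x) = ∫ W(x,y) dy` of a kernel. -/
def kernelDegree (W : unitInterval → unitInterval → ℝ) (x : unitInterval) : ℝ :=
  ∫ y, W x y

/-- The `L¹` norm on the unit square. -/
def kernelNormOne (W : unitInterval → unitInterval → ℝ) : ℝ :=
  (eLpNorm (Function.uncurry W) 1 (volume : Measure (unitInterval × unitInterval))).toReal

/-- The `L^∞` (essential supremum) norm on the unit interval. -/
def funNormTop (f : unitInterval → ℝ) : ℝ :=
  (eLpNorm f ∞ (volume : Measure unitInterval)).toReal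

/-- The cells `(i/n, (i+1)/n]`, `i = 0, …, n-1`. -/
def cell (n : ℕ) (i : Fin n) : Set unitInterval :=
  {x | ((i : ℕ) : ℝ) / n < (x : ℝ) ∧ (x : ℝ) ≤ (((i : ℕ) : ℝ) + 1) / n}

/-- The piecewise constant kernel equal to `A i j` on the product of the `i`-th and `j`-th cells. -/
def stepKernel {n : ℕ} (A : Matrix (Fin n) (Fin n) ℝ) (x y : unitInterval) : ℝ :=
  ∑ i, ∑ j, A i j * (cell n i).indicator 1 x * (cell n j).indicator 1 y

/-- The normalized degree `d_i / n` of vertex `i`. -/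
def normalizedDegree {n : ℕ} (A : Matrix (Fin n) (Fin n) ℝ) (i : Fin n) : ℝ :=
  (∑ j, A i j) / n

/-- Deterministic latent variables: the points `1/n, 2/n, …, n/n`. -/
def IsDeterministicLatent {Ω : Type*} {n : ℕ} (X : Fin n → Ω → unitInterval) : Prop :=
  ∀ i ω, (X i ω : ℝ) = (((i : ℕ) : ℝ) + 1) / n

/-- The order statistics of a finite tuple: the tuple rearranged in increasing order. -/
def orderStatistics {n : ℕ} (u : Fin n → unitInterval) : Fin n → unitInterval :=
  u ∘ Tuple.sort u

/-- Stochastic latent variables: the order statistics of `n` independent random variables, each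
uniformly distributed on the unit interval. -/
def IsStochasticLatent {Ω : Type*} [MeasurableSpace Ω] (μ : Measure Ω) {n : ℕ}
    (X : Fin n → Ω → unitInterval) : Prop :=
  ∃ U : Fin n → Ω → unitInterval,
    (∀ i, Measurable (U i)) ∧ iIndepFun U μ ∧
    (∀ i, μ.map (U i) = (volume : Measure unitInterval)) ∧
    ∀ i ω, X i ω = orderStatistics (fun k => U k ω) i

/-- Conditionally on the points `X_1, …, X_n`, the variables `η_{ij}`, `i < j`, are independent
Bernoulli variables with parameters `ε |W(X_i, X_j)|`: every pattern `e` of their values has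
conditional probability the product over `i < j` of the Bernoulli probabilities. Only the
`η_{ij}` with `i < j` matter. For constant `X` the conditioning is trivial. -/
structure IsEdgeSample {Ω : Type*} [MeasurableSpace Ω] (μ : Measure Ω)
    (W : unitInterval → unitInterval → ℝ) (ε : ℝ) {n : ℕ}
    (X : Fin n → Ω → unitInterval) (η : Fin n → Fin n → Ω → Bool) : Prop where
  measurable : ∀ i j, i < j → Measurable (η i j)
  condProb : ∀ e : Fin n → Fin n → Bool,
    μ⟦{ω | ∀ i j, i < j → η i j ω = e i j} |
        MeasurableSpace.comap (fun ω i => X i ω) MeasurableSpace.pi⟧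
      =ᵐ[μ] fun ω => ∏ i, ∏ j ∈ Finset.Ioi i,
        if e i j = true then ε * |W (X i ω) (X j ω)| else 1 - ε * |W (X i ω) (X j ω)|

/-- The symmetric adjacency matrix, with zero diagonal and `A_{ij} = sign (W(X_i, X_j)) η_{ij}`
for `i < j`, of the graph sampled at the points `x` with edge indicators `h`. -/
def sampledAdjacency (W : unitInterval → unitInterval → ℝ) {n : ℕ}
    (x : Fin n → unitInterval) (h : Fin n → Fin n → Bool) : Matrix (Fin n) (Fin n) ℝ :=
  fun i j =>
    if i = j then 0
    else (SignType.sign (W (x i) (x j)) : ℝ) *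
      (if h (min i j) (max i j) = true then 1 else 0)

end

/-!
The norms in question are finite sums: the degree function of the step kernel equals `d_i / n` on
the `i`-th cell, so its supremum norm is the largest normalized degree and, all entries being
nonnegative, the `L¹` norm of the kernel is the mean normalized degree
(`isGreatest_funNormTop_kernelDegree`, `kernelNormOne_stepKernel`). Since the mean is at most the
maximum, it suffices to bound the mean from below and the maximum from above, both by a constant
times the sparsity parameter `ε`, eventually almost surely.

*Edges given positions.* Given the positions, the edges are independent, so the conditional Laplace
transform of a weighted edge count is a product over the pairs `p` of vertices of
`1 + (exp t_p - 1) r_p ≤ exp ((exp t_p - 1) r_p)`, where `r_p = ε W` is the edge probability.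
Dividing by this product gives a variable of mean one, whence a Chernoff bound centred at the random
quantity `∑ (exp t_p - 1) r_p` (`IsEdgeSample.measureReal_le_exp`). With weight `1` on the pairs
at one vertex it bounds all degrees by `2 ε n + 3 log n`; with weight `-1` everywhere it bounds the
number of edges from below by `(ε / 2) ∑ W(X_i, X_j) - 2 log n`. The exceptional probabilities are
at most `n⁻²`, so the Borel-Cantelli lemma applies without any assumption on the joint law for
different `n`, and `log n = o(ε n)` makes the logarithms negligible.

*Positions.* It remains to see that `∑_{i<j} W(X_i, X_j) ≥ δ n²` eventually. For equally spaced
points, `W` is bounded below on a box around a continuity point where it is positive, and the box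
contains a positive proportion of the grid (`exists_quadratic_bound_of_deterministic`). For order
statistics, sorting permutes the pairs, so the uniform sample itself may be used. Only pairs with
one vertex in each half of the sample are kept; integrating out one half after the other shows that
their sum is of order `n²` outside an event of exponentially small probability
(`integral_exp_neg_bipartite_le`, `exists_quadratic_bound_of_stochastic`).
-/

/-! ### Norms of step kernels -/

lemma measurableSet_cell (n : ℕ) (i : Fin n) : MeasurableSet (cell n i) := by
  unfold cell
  exact (measurableSet_lt measurable_const measurable_subtype_coe).inter
    (measurableSet_le measurable_subtype_coe measurable_const)

lemma volume_cell (n : ℕ) (i : Fin n) :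
    (volume : Measure unitInterval) (cell n i) = ENNReal.ofReal (1 / n) := by
  have hn : (0 : ℝ) < n := by exact_mod_cast i.pos
  have hi : ((i : ℕ) : ℝ) + 1 ≤ n := by exact_mod_cast i.isLt
  have himage : (Subtype.val '' cell n i : Set ℝ) =
      Set.Ioc (((i : ℕ) : ℝ) / n) ((((i : ℕ) : ℝ) + 1) / n) := by
    ext x
    constructor
    · rintro ⟨y, hy, rfl⟩
      exact hy
    · rintro ⟨h1, h2⟩
      have h0 : (0 : ℝ) ≤ ((i : ℕ) : ℝ) / n := by positivity
      have h3 : (((i : ℕ) : ℝ) + 1) / n ≤ 1 := (div_le_one hn).2 hi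
      exact ⟨⟨x, h0.trans h1.le, h2.trans h3⟩, ⟨h1, h2⟩, rfl⟩
  rw [unitInterval.volume_apply, himage, Real.volume_Ioc]
  congr 1
  ring

lemma cell_indicator_of_mem {n : ℕ} {i : Fin n} {x : unitInterval} (hx : x ∈ cell n i)
    (k : Fin n) : (cell n k).indicator (1 : unitInterval → ℝ) x = if k = i then 1 else 0 := by
  split_ifs with h
  · subst h; simp [hx]
  · refine Set.indicator_of_notMem (fun hk => h ?_) _
    have hn : (0 : ℝ) < n := by exact_mod_cast i.pos
    obtain ⟨h1, h2⟩ := hx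
    obtain ⟨h3, h4⟩ := hk
    have a := h1.trans_le h4
    have b := h3.trans_le h2
    rw [div_lt_div_iff_of_pos_right hn] at a b
    ext
    have a' : (i : ℕ) < k + 1 := by exact_mod_cast a
    have b' : (k : ℕ) < i + 1 := by exact_mod_cast b
    omega

lemma integrable_cell_indicator (n : ℕ) (i : Fin n) :
    Integrable ((cell n i).indicator (1 : unitInterval → ℝ)) :=
  (integrable_const (1 : ℝ)).indicator (measurableSet_cell n i)

lemma integral_cell_indicator (n : ℕ) (i : Fin n) :
    ∫ x, (cell n i).indicator (1 : unitInterval → ℝ) x = 1 / n := by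
  rw [integral_indicator_one (measurableSet_cell n i), Measure.real, volume_cell,
    ENNReal.toReal_ofReal (by positivity)]

lemma kernelDegree_stepKernel {n : ℕ} (A : Matrix (Fin n) (Fin n) ℝ) (x : unitInterval) :
    kernelDegree (stepKernel A) x =
      ∑ i, normalizedDegree A i * (cell n i).indicator 1 x := by
  unfold kernelDegree stepKernel normalizedDegree
  have hint : ∀ i j, Integrable fun y : unitInterval =>
      A i j * (cell n i).indicator 1 x * (cell n j).indicator 1 y :=
    fun i j => (integrable_cell_indicator n j).const_mul _
  rw [integral_finsetSum _ fun i _ => integrable_finsetSum _ fun j _ => hint i j]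
  refine Finset.sum_congr rfl fun i _ => ?_
  rw [integral_finsetSum _ fun j _ => hint i j]
  simp_rw [integral_const_mul, integral_cell_indicator]
  rw [Finset.sum_div, Finset.sum_mul]
  exact Finset.sum_congr rfl fun j _ => by ring

/-- For a nonnegative matrix, the supremum norm of the degree function of the step kernel is the
maximum of the normalized degrees. -/
lemma isGreatest_funNormTop_kernelDegree {n : ℕ} (hn : 1 ≤ n) {A : Matrix (Fin n) (Fin n) ℝ}
    (hA : ∀ i j, 0 ≤ A i j) :
    IsGreatest (Set.range (normalizedDegree A))
      (funNormTop (kernelDegree (stepKernel A))) := by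
  have : Nonempty (Fin n) := ⟨⟨0, hn⟩⟩
  have hd : ∀ i, 0 ≤ normalizedDegree A i := fun i =>
    div_nonneg (Finset.sum_nonneg fun j _ => hA i j) (Nat.cast_nonneg n)
  obtain ⟨m, hm⟩ := Finite.exists_max (normalizedDegree A)
  have hcell : ∀ i, ∀ x ∈ cell n i,
      kernelDegree (stepKernel A) x = normalizedDegree A i := fun i x hx => by
    rw [kernelDegree_stepKernel]
    simp [cell_indicator_of_mem hx]
  have key : eLpNorm (kernelDegree (stepKernel A)) ∞ (volume : Measure unitInterval) =
      ENNReal.ofReal (normalizedDegree A m) := by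
    rw [eLpNorm_exponent_top]
    apply le_antisymm
    · refine eLpNormEssSup_le_of_ae_bound (Eventually.of_forall fun x => ?_)
      by_cases h : ∃ i, x ∈ cell n i
      · obtain ⟨i, hi⟩ := h
        rw [hcell i x hi, Real.norm_of_nonneg (hd i)]
        exact hm i
      · push Not at h
        rw [kernelDegree_stepKernel, Finset.sum_eq_zero fun i _ => by simp [h i]]
        simpa using hd m
    -- the maximum is attained on a whole cell, which is not a null set
    · have hpos : (volume : Measure unitInterval) (cell n m) ≠ 0 := by
        rw [volume_cell]
        simpa using m.pos.ne'
      obtain ⟨x, hx, hle⟩ := ((frequently_ae_mem_iff.2 hpos).and_eventually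
        (enorm_ae_le_eLpNormEssSup (kernelDegree (stepKernel A)) volume)).exists
      rwa [hcell m x hx, Real.enorm_of_nonneg (hd m)] at hle
  rw [funNormTop, key, ENNReal.toReal_ofReal (hd m)]
  exact ⟨⟨m, rfl⟩, by rintro _ ⟨i, rfl⟩; exact hm i⟩

lemma kernelNormOne_stepKernel {n : ℕ} {A : Matrix (Fin n) (Fin n) ℝ}
    (hA : ∀ i j, 0 ≤ A i j) :
    kernelNormOne (stepKernel A) = (∑ i, normalizedDegree A i) / n := by
  have hind : ∀ (i : Fin n) (x : unitInterval),
      (0 : ℝ) ≤ (cell n i).indicator 1 x := fun i x =>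
    Set.indicator_nonneg (fun _ _ => zero_le_one) x
  have hint : Integrable (Function.uncurry (stepKernel A))
      (volume : Measure (unitInterval × unitInterval)) := by
    have hsum : Function.uncurry (stepKernel A) = fun z : unitInterval × unitInterval =>
        ∑ i, ∑ j, A i j * (cell n i).indicator 1 z.1 * (cell n j).indicator 1 z.2 := rfl
    rw [hsum]
    refine integrable_finsetSum _ fun i _ => integrable_finsetSum _ fun j _ => ?_
    have := ((integrable_cell_indicator n i).mul_prod (integrable_cell_indicator n j)).const_mul
      (A i j)
    refine this.congr (Eventually.of_forall fun z => ?_)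
    exact (mul_assoc _ _ _).symm
  rw [kernelNormOne, eLpNorm_one_eq_lintegral_enorm, ← integral_norm_eq_lintegral_enorm hint.1]
  have hnorm : ∀ z : unitInterval × unitInterval,
      ‖Function.uncurry (stepKernel A) z‖ = Function.uncurry (stepKernel A) z := fun z =>
    Real.norm_of_nonneg <| show 0 ≤ stepKernel A z.1 z.2 from
      Finset.sum_nonneg fun i _ => Finset.sum_nonneg fun j _ =>
        mul_nonneg (mul_nonneg (hA i j) (hind i _)) (hind j _)
  simp_rw [hnorm]
  rw [Measure.volume_eq_prod, integral_prod _ hint]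
  have : ∀ x, ∫ y, Function.uncurry (stepKernel A) (x, y) =
      ∑ i, normalizedDegree A i * (cell n i).indicator 1 x := fun x =>
    kernelDegree_stepKernel A x
  simp_rw [this]
  rw [integral_finsetSum _ fun i _ => (integrable_cell_indicator n i).const_mul _]
  simp_rw [integral_const_mul, integral_cell_indicator]
  rw [Finset.sum_div]
  exact Finset.sum_congr rfl fun j _ => by ring

lemma sampledAdjacency_nonneg {W : unitInterval → unitInterval → ℝ} (hW : ∀ x y, 0 ≤ W x y)
    {n : ℕ} (x : Fin n → unitInterval) (h : Fin n → Fin n → Bool) (i j : Fin n) :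
    0 ≤ sampledAdjacency W x h i j := by
  unfold sampledAdjacency
  split_ifs
  · exact le_rfl
  · rcases (hW (x i) (x j)).eq_or_lt with h0 | h0
    · simp [← h0]
    · simp [sign_pos h0]
  · simp

/-! ### Chernoff bounds for conditionally independent edges -/

/-- The pairs `i < j` of vertices. -/
abbrev VertexPair (n : ℕ) : Type := {p : Fin n × Fin n // p.1 < p.2}

/-- A product over `i` and `j > i` as a product over vertex pairs. -/
lemma prod_prod_Ioi_eq_prod_vertexPair {M : Type*} [CommMonoid M] {n : ℕ}
    (f : Fin n → Fin n → M) :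
    ∏ i, ∏ j ∈ Finset.Ioi i, f i j = ∏ p : VertexPair n, f p.1.1 p.1.2 := by
  have h : ∀ i, ∏ j ∈ Finset.Ioi i, f i j = ∏ j, if i < j then f i j else 1 := fun i => by
    rw [← Finset.prod_filter, Finset.filter_lt_eq_Ioi]
  simp_rw [h]
  rw [← Fintype.prod_prod_type' fun i j => if i < j then f i j else 1, ← Finset.prod_filter]
  exact Finset.prod_subtype _ (by simp) _

/-- Conditioning on `m` lets the indicators of finitely many events be replaced, under the
integral and against bounded `m`-measurable factors, by their conditional probabilities. -/
lemma integral_sum_indicator_mul {Ω ι : Type*} [Fintype ι] {m m₀ : MeasurableSpace Ω}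
    {μ : Measure Ω} [IsProbabilityMeasure μ] (hm : m ≤ m₀) {S : ι → Set Ω}
    (hS : ∀ i, MeasurableSet (S i)) {q : ι → Ω → ℝ} (hq : ∀ i, μ⟦S i|m⟧ =ᵐ[μ] q i)
    (c : ι → ℝ) {Z : Ω → ℝ} (hZ : AEStronglyMeasurable[m] Z μ) {C : ℝ}
    (hC : ∀ ω, ‖Z ω‖ ≤ C) :
    Integrable (fun ω => (∑ i, c i * (S i).indicator 1 ω) * Z ω) μ ∧
      ∫ ω, (∑ i, c i * (S i).indicator 1 ω) * Z ω ∂μ = ∫ ω, (∑ i, c i * q i ω) * Z ω ∂μ := by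
  have hZ₀ : AEStronglyMeasurable Z μ := hZ.mono hm
  have hI : ∀ i, Integrable ((S i).indicator (fun _ => (1 : ℝ))) μ := fun i =>
    (integrable_const 1).indicator (hS i)
  have hIZ : ∀ i, Integrable ((S i).indicator (fun _ => (1 : ℝ)) * Z) μ := fun i =>
    (hI i).mul_bdd hZ₀ (Eventually.of_forall hC)
  have hpull : ∀ i, μ[(S i).indicator (fun _ => (1 : ℝ)) * Z|m] =ᵐ[μ] fun ω => q i ω * Z ω :=
    fun i => (condExp_mul_of_aestronglyMeasurable_right hZ (hIZ i) (hI i)).trans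
      ((hq i).mul (ae_eq_refl Z))
  have hqZ : ∀ i, Integrable (fun ω => q i ω * Z ω) μ := fun i =>
    integrable_condExp.congr (hpull i)
  have hIZ' : ∀ i, Integrable (fun ω => (S i).indicator 1 ω * Z ω) μ := hIZ
  have hint : ∀ i, ∫ ω, (S i).indicator 1 ω * Z ω ∂μ =
      ∫ ω, q i ω * Z ω ∂μ := fun i => by
    rw [← integral_congr_ae (hpull i), integral_condExp hm]
    rfl
  simp_rw [Finset.sum_mul, mul_assoc]
  refine ⟨integrable_finsetSum _ fun i _ => (hIZ' i).const_mul (c i), ?_⟩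
  rw [integral_finsetSum _ fun i _ => (hIZ' i).const_mul (c i),
    integral_finsetSum _ fun i _ => (hqZ i).const_mul (c i)]
  refine Finset.sum_congr rfl fun i _ => ?_
  rw [integral_const_mul, integral_const_mul]
  rw [hint i]

/-- An edge pattern on vertex pairs, extended by `false`. -/
def extendPattern {n : ℕ} (e : VertexPair n → Bool) (i j : Fin n) : Bool :=
  if h : i < j then e ⟨(i, j), h⟩ else false

lemma extendPattern_apply {n : ℕ} (e : VertexPair n → Bool) (p : VertexPair n) :
    extendPattern e p.1.1 p.1.2 = e p := by
  simp [extendPattern, p.2]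

/-- The event that the edge indicators show the pattern `e`. -/
def patternEvent {Ω : Type*} {n : ℕ} (η : Fin n → Fin n → Ω → Bool) (e : VertexPair n → Bool) :
    Set Ω :=
  {ω | ∀ i j, i < j → η i j ω = extendPattern e i j}

lemma mem_patternEvent {Ω : Type*} {n : ℕ} {η : Fin n → Fin n → Ω → Bool}
    {e : VertexPair n → Bool} {ω : Ω} :
    ω ∈ patternEvent η e ↔ e = fun p : VertexPair n => η p.1.1 p.1.2 ω := by
  constructor
  · intro h
    funext p
    rw [h _ _ p.2, extendPattern_apply]
  · rintro rfl i j hij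
    simp [extendPattern, hij]

/-- The conditional probability of the pattern `e` when the edge `p` has parameter `r p`. -/
def patternProb {n : ℕ} (r : VertexPair n → ℝ) (e : VertexPair n → Bool) : ℝ :=
  ∏ p, if e p = true then r p else 1 - r p

lemma sum_exp_mul_patternProb {n : ℕ} (r t : VertexPair n → ℝ) :
    ∑ e, Real.exp (∑ p, t p * if e p = true then 1 else 0) * patternProb r e =
      ∏ p, (Real.exp (t p) * r p + (1 - r p)) := by
  have h : ∀ p, Real.exp (t p) * r p + (1 - r p) =
      ∑ b : Bool, Real.exp (t p * if b = true then 1 else 0) *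
        if b = true then r p else 1 - r p := fun p => by simp
  simp_rw [h]
  rw [Fintype.prod_sum]
  refine Finset.sum_congr rfl fun e _ => ?_
  rw [Real.exp_sum, patternProb, Finset.prod_mul_distrib]

lemma sum_patternProb {n : ℕ} (r : VertexPair n → ℝ) : ∑ e, patternProb r e = 1 := by
  simpa using sum_exp_mul_patternProb r 0

/-- The parameter of the edge `p`. -/
def edgeProb {Ω : Type*} (W : unitInterval → unitInterval → ℝ) (ε : ℝ) {n : ℕ}
    (X : Fin n → Ω → unitInterval) (ω : Ω) (p : VertexPair n) : ℝ :=
  ε * |W (X p.1.1 ω) (X p.1.2 ω)|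

namespace IsEdgeSample

variable {Ω : Type*} [m₀ : MeasurableSpace Ω] {μ : Measure Ω} {W : unitInterval → unitInterval → ℝ}
  {ε : ℝ} {n : ℕ} {X : Fin n → Ω → unitInterval} {η : Fin n → Fin n → Ω → Bool}

lemma condProb_patternEvent (h : IsEdgeSample μ W ε X η) (e : VertexPair n → Bool) :
    μ⟦patternEvent η e | MeasurableSpace.comap (fun ω i => X i ω) MeasurableSpace.pi⟧
      =ᵐ[μ] fun ω => patternProb (edgeProb W ε X ω) e := by
  refine (h.condProb (extendPattern e)).trans (Eventually.of_forall fun ω => ?_)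
  dsimp only
  rw [prod_prod_Ioi_eq_prod_vertexPair fun i j => if extendPattern e i j = true then
    ε * |W (X i ω) (X j ω)| else 1 - ε * |W (X i ω) (X j ω)|]
  simp only [extendPattern_apply]
  rfl

/-- The latent variables of an edge sample are measurable: otherwise all conditional probabilities
would vanish by convention, while those of the edge patterns sum to one. -/
lemma comap_le [IsProbabilityMeasure μ] (h : IsEdgeSample μ W ε X η) :
    MeasurableSpace.comap (fun ω i => X i ω) MeasurableSpace.pi ≤ m₀ := by
  by_contra hm
  have hzero : ∀ᵐ ω ∂μ, ∀ e, patternProb (edgeProb W ε X ω) e = 0 := by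
    refine ae_all_iff.2 fun e => ?_
    have := h.condProb_patternEvent e
    rw [condExp_of_not_le hm] at this
    exact this.mono fun ω hω => hω.symm
  obtain ⟨ω, hω⟩ := hzero.exists
  have := sum_patternProb (edgeProb W ε X ω)
  simp [hω] at this

lemma measurableSet_patternEvent (h : IsEdgeSample μ W ε X η) (e : VertexPair n → Bool) :
    MeasurableSet (patternEvent η e) := by
  have : patternEvent η e =
      ⋂ i, ⋂ j, ⋂ _ : i < j, η i j ⁻¹' {extendPattern e i j} := by
    ext ω
    simp [patternEvent]
  rw [this]
  exact MeasurableSet.iInter fun i => MeasurableSet.iInter fun j => MeasurableSet.iInter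
    fun hij => h.measurable i j hij (measurableSet_singleton _)

/-- Almost surely, edges are present only where the graphon does not vanish. -/
lemma ae_ne_zero_of_edge [IsProbabilityMeasure μ] (h : IsEdgeSample μ W ε X η) :
    ∀ᵐ ω ∂μ, ∀ p : VertexPair n, η p.1.1 p.1.2 ω = true →
      W (X p.1.1 ω) (X p.1.2 ω) ≠ 0 := by
  have hm := h.comap_le
  -- almost surely the pattern that occurs has positive conditional probability
  have hpat : ∀ e, ∀ᵐ ω ∂μ, ω ∈ patternEvent η e → patternProb (edgeProb W ε X ω) e ≠ 0 := by
    intro e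
    set g := μ⟦patternEvent η e |
      MeasurableSpace.comap (fun ω i => X i ω) MeasurableSpace.pi⟧ with hg
    have hB : MeasurableSet[MeasurableSpace.comap (fun ω i => X i ω) MeasurableSpace.pi]
        {ω | g ω = 0} := (stronglyMeasurable_condExp.measurable) (measurableSet_singleton 0)
    have hint : ∫ ω in {ω | g ω = 0}, (patternEvent η e).indicator (fun _ => (1 : ℝ)) ω ∂μ = 0 := by
      rw [← setIntegral_condExp hm ((integrable_const 1).indicator
        (h.measurableSet_patternEvent e)) hB]
      exact setIntegral_eq_zero_of_forall_eq_zero fun ω hω => hω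
    rw [integral_indicator_const _ (h.measurableSet_patternEvent e), smul_eq_mul, mul_one,
      measureReal_restrict_apply (h.measurableSet_patternEvent e), measureReal_eq_zero_iff] at hint
    have hnull : ∀ᵐ ω ∂μ, ω ∉ patternEvent η e ∩ {ω | g ω = 0} :=
      measure_eq_zero_iff_ae_notMem.1 hint
    filter_upwards [hnull, h.condProb_patternEvent e] with ω h1 h2 h3 h4
    exact h1 ⟨h3, h2.trans h4⟩
  filter_upwards [ae_all_iff.2 hpat] with ω hω p hp hW
  refine hω _ (mem_patternEvent.2 rfl) (Finset.prod_eq_zero (Finset.mem_univ p) ?_)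
  simp [hp, edgeProb, hW]

/-- The exponential of a weighted edge count, divided by its conditional expectation, has mean
one. -/
lemma integrable_and_integral_exp_div [IsProbabilityMeasure μ] (h : IsEdgeSample μ W ε X η)
    (hr : ∀ ω p, edgeProb W ε X ω p ∈ Set.Icc (0 : ℝ) 1) (t : VertexPair n → ℝ) :
    Integrable (fun ω =>
      Real.exp (∑ p : VertexPair n, t p * if η p.1.1 p.1.2 ω = true then 1 else 0)
      * (∏ p, (Real.exp (t p) * edgeProb W ε X ω p + (1 - edgeProb W ε X ω p)))⁻¹) μ ∧
    ∫ ω, Real.exp (∑ p : VertexPair n, t p * if η p.1.1 p.1.2 ω = true then 1 else 0)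
      * (∏ p, (Real.exp (t p) * edgeProb W ε X ω p + (1 - edgeProb W ε X ω p)))⁻¹ ∂μ = 1 := by
  set c : (VertexPair n → Bool) → ℝ := fun e =>
    Real.exp (∑ p, t p * if e p = true then 1 else 0) with hc
  set Q : Ω → ℝ := fun ω =>
    ∏ p, (Real.exp (t p) * edgeProb W ε X ω p + (1 - edgeProb W ε X ω p)) with hQ
  have hlow : ∀ ω, ∏ p, Real.exp (-|t p|) ≤ Q ω := fun ω => by
    refine Finset.prod_le_prod (fun p _ => (Real.exp_pos _).le) fun p _ => ?_
    obtain ⟨h0, h1⟩ := hr ω p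
    have e1 : Real.exp (-|t p|) ≤ Real.exp (t p) := Real.exp_le_exp.2 (neg_abs_le _)
    have e2 : Real.exp (-|t p|) ≤ 1 := Real.exp_le_one_iff.2 (by simp)
    nlinarith
  have hpos : 0 < ∏ p, Real.exp (-|t p|) := Finset.prod_pos fun p _ => Real.exp_pos _
  have hQsum : ∀ ω, Q ω = ∑ e, c e * patternProb (edgeProb W ε X ω) e := fun ω =>
    (sum_exp_mul_patternProb _ _).symm
  -- `W` itself need not be Borel; `Q` is measurable in the positions up to a null set because it is
  -- a combination of conditional probabilities
  have hQmeas : AEStronglyMeasurable[MeasurableSpace.comap (fun ω i => X i ω) MeasurableSpace.pi]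
      (fun ω => (Q ω)⁻¹) μ := by
    refine ⟨fun ω => (∑ e, c e * (μ⟦patternEvent η e |
      MeasurableSpace.comap (fun ω i => X i ω) MeasurableSpace.pi⟧) ω)⁻¹, ?_, ?_⟩
    · refine Measurable.stronglyMeasurable (Measurable.inv ?_)
      exact Finset.measurable_fun_sum _ fun e _ => stronglyMeasurable_condExp.measurable.const_mul _
    · filter_upwards [ae_all_iff.2 h.condProb_patternEvent] with ω hω
      simp only [hQsum, hω]
  have hsum : ∀ ω, ∑ e, c e * (patternEvent η e).indicator 1 ω =
      Real.exp (∑ p : VertexPair n, t p * if η p.1.1 p.1.2 ω = true then 1 else 0) := fun ω => by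
    rw [Finset.sum_eq_single fun p : VertexPair n => η p.1.1 p.1.2 ω]
    · rw [Set.indicator_of_mem (mem_patternEvent.2 rfl)]
      simp [hc]
    · intro e _ he
      rw [Set.indicator_of_notMem (mt mem_patternEvent.1 he), mul_zero]
    · simp
  have key := integral_sum_indicator_mul h.comap_le h.measurableSet_patternEvent
    h.condProb_patternEvent c hQmeas (C := (∏ p, Real.exp (-|t p|))⁻¹) fun ω => by
      rw [Real.norm_of_nonneg (inv_nonneg.2 (hpos.le.trans (hlow ω)))]
      exact inv_anti₀ hpos (hlow ω)
  simp_rw [hsum, ← hQsum, mul_inv_cancel₀ (hpos.trans_le (hlow _)).ne'] at key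
  simpa using key

/-- A Chernoff bound for weighted numbers of edges, with the random centring given by the
conditional edge probabilities. -/
lemma measureReal_le_exp [IsProbabilityMeasure μ] (h : IsEdgeSample μ W ε X η)
    (hr : ∀ ω p, edgeProb W ε X ω p ∈ Set.Icc (0 : ℝ) 1) (t : VertexPair n → ℝ) (s : ℝ) :
    μ.real {ω | s + ∑ p, (Real.exp (t p) - 1) * edgeProb W ε X ω p ≤
      ∑ p : VertexPair n, t p * if η p.1.1 p.1.2 ω = true then 1 else 0} ≤ Real.exp (-s) := by
  obtain ⟨hint, hone⟩ := h.integrable_and_integral_exp_div hr t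
  have hpos : ∀ ω p, 0 < Real.exp (t p) * edgeProb W ε X ω p + (1 - edgeProb W ε X ω p) := by
    intro ω p
    obtain ⟨h0, h1⟩ := hr ω p
    rcases h0.eq_or_lt with h0 | h0
    · simp [← h0]
    · have := mul_pos (Real.exp_pos (t p)) h0
      linarith
  have markov := mul_meas_ge_le_integral_of_nonneg (Eventually.of_forall fun ω => mul_nonneg
    (Real.exp_pos (∑ p : VertexPair n, t p * if η p.1.1 p.1.2 ω = true then 1 else 0)).le
      (inv_nonneg.2 (Finset.prod_nonneg fun p _ => (hpos ω p).le))) hint (Real.exp s)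
  rw [hone, mul_comm] at markov
  rw [Real.exp_neg, ← one_div, le_div_iff₀ (Real.exp_pos s)]
  refine le_trans (mul_le_mul_of_nonneg_right (measureReal_mono fun ω hω => ?_)
    (Real.exp_pos s).le) markov
  simp only [Set.mem_ofPred_eq] at hω ⊢
  rw [← div_eq_mul_inv, le_div_iff₀ (Finset.prod_pos fun p _ => hpos ω p)]
  refine le_trans ?_ (Real.exp_le_exp.2 hω)
  rw [Real.exp_add, Real.exp_sum]
  refine mul_le_mul_of_nonneg_left (Finset.prod_le_prod (fun p _ => (hpos ω p).le) fun p _ => ?_)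
    (Real.exp_pos s).le
  have := Real.add_one_le_exp ((Real.exp (t p) - 1) * edgeProb W ε X ω p)
  linarith

end IsEdgeSample

/-! ### Sums over pairs of vertices -/

lemma sum_offDiag_eq_two_mul_sum_vertexPair {n : ℕ} {f : Fin n → Fin n → ℝ}
    (hf : ∀ i j, f i j = f j i) :
    ∑ i, ∑ j, (if i = j then 0 else f i j) = 2 * ∑ p : VertexPair n, f p.1.1 p.1.2 := by
  have hsplit : ∀ i j : Fin n, (if i = j then 0 else f i j) =
      (if i < j then f i j else 0) + (if j < i then f i j else 0) := fun i j => by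
    rcases lt_trichotomy i j with h | h | h
    · simp [h, h.ne, h.not_gt]
    · simp [h]
    · simp [h, h.ne', h.not_gt]
  have hpair : ∑ i, ∑ j, (if i < j then f i j else 0) = ∑ p : VertexPair n, f p.1.1 p.1.2 := by
    rw [← Fintype.sum_prod_type' fun i j => if i < j then f i j else 0, ← Finset.sum_filter]
    exact Finset.sum_subtype _ (by simp) _
  simp_rw [hsplit, Finset.sum_add_distrib]
  rw [Finset.sum_comm (f := fun i j => if j < i then f i j else 0)]
  simp_rw [fun i j => hf j i]
  rw [hpair, two_mul]

lemma sum_comp_le_sum_of_injective {α β : Type*} [Fintype α] [Fintype β] {g : α → β}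
    (hg : g.Injective) {f : β → ℝ} (hf : ∀ b, 0 ≤ f b) : ∑ a, f (g a) ≤ ∑ b, f b := by
  have := Finset.sum_map Finset.univ ⟨g, hg⟩ f
  simp only [Function.Embedding.coeFn_mk] at this
  rw [← this]
  exact Finset.sum_le_univ_sum_of_nonneg hf

/-- The off-diagonal part of a rectangular block is bounded by twice the sum over vertex pairs. -/
lemma sum_block_le_two_mul_sum_vertexPair {n k : ℕ} {f : Fin n → Fin n → ℝ}
    (hf : ∀ i j, f i j = f j i) (hf0 : ∀ i j, 0 ≤ f i j) {ga gb : Fin k → Fin n}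
    (ha : ga.Injective) (hb : gb.Injective) :
    ∑ a, ∑ b, (if ga a = gb b then 0 else f (ga a) (gb b)) ≤
      2 * ∑ p : VertexPair n, f p.1.1 p.1.2 := by
  rw [← sum_offDiag_eq_two_mul_sum_vertexPair hf]
  have h0 : ∀ i j, 0 ≤ (if i = j then 0 else f i j) := fun i j => by
    split_ifs
    exacts [le_rfl, hf0 i j]
  calc _ ≤ ∑ a, ∑ j, (if ga a = j then 0 else f (ga a) j) :=
        Finset.sum_le_sum fun a _ =>
          sum_comp_le_sum_of_injective (f := fun j => if ga a = j then 0 else f (ga a) j) hb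
            fun j => h0 _ j
    _ ≤ _ := sum_comp_le_sum_of_injective
        (f := fun i => ∑ j, if i = j then 0 else f i j) ha
          fun i => Finset.sum_nonneg fun j _ => h0 i j

/-- The sum over the pairs containing the vertex `i`. -/
lemma sum_incident_eq {n : ℕ} {g : Fin n → Fin n → ℝ} (hg : ∀ i j, g i j = g j i) (i : Fin n) :
    ∑ p : VertexPair n, ((if p.1.1 = i then 1 else 0) + if p.1.2 = i then 1 else 0) *
      g p.1.1 p.1.2 = ∑ j, if i = j then 0 else g i j := by
  have h := sum_offDiag_eq_two_mul_sum_vertexPair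
    (f := fun k l => ((if k = i then 1 else 0) + if l = i then 1 else 0) * g k l)
    fun k l => by rw [hg k l, add_comm]
  have hsplit : ∀ k l : Fin n, (if k = l then 0 else
      ((if k = i then 1 else 0) + if l = i then 1 else 0) * g k l) =
        (if k = i then (if i = l then 0 else g i l) else 0) +
          (if l = i then (if i = k then 0 else g i k) else 0) := fun k l => by
    by_cases hkl : k = l
    · subst hkl
      by_cases hk : k = i
      · subst hk
        simp
      · simp [hk]
    · by_cases hk : k = i
      · subst hk
        simp [hkl, Ne.symm hkl]
      · by_cases hl : l = i
        · subst hl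
          simp [hkl, Ne.symm hkl, hg k l]
        · simp [hkl, hk, hl]
  simp_rw [hsplit, Finset.sum_add_distrib] at h
  rw [Finset.sum_comm] at h
  simp only [Finset.sum_ite_eq', Finset.mem_univ, if_true] at h
  linarith

/-! ### Density of the latent positions: equally spaced points -/

lemma kernelNormOne_eq_zero_of_ae {W : unitInterval → unitInterval → ℝ}
    (h : Function.uncurry W =ᵐ[volume] 0) : kernelNormOne W = 0 := by
  rw [kernelNormOne, eLpNorm_congr_ae h]
  simp

/-- A point of the unit interval is adjacent to an interval of prescribed small length. -/
lemma exists_interval_near (z : unitInterval) {ρ : ℝ} (hρ1 : ρ ≤ 1) :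
    ∃ a : ℝ, 0 ≤ a ∧ a + ρ ≤ 1 ∧ ∀ x, a < x → x < a + ρ → |x - z| < ρ := by
  obtain ⟨z, h0, h1⟩ := z
  rcases le_total ρ z with h | h
  · refine ⟨z - ρ, by linarith, by linarith, fun x hx hx' => ?_⟩
    rw [abs_lt]
    constructor <;> dsimp only <;> linarith
  · refine ⟨0, le_rfl, by linarith, fun x hx hx' => ?_⟩
    rw [abs_lt]
    constructor <;> dsimp only <;> linarith

/-- An interval of length `ρ` inside the unit interval contains at least `⌈ρ n⌉ - 1` of the grid
points `1/n, …, n/n`. -/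
lemma exists_injective_grid (n : ℕ) {a ρ : ℝ} (ha : 0 ≤ a) (haρ : a + ρ ≤ 1) :
    ∃ g : Fin (⌈ρ * n⌉₊ - 1) → Fin n, g.Injective ∧
      ∀ k, a < (((g k : ℕ) : ℝ) + 1) / n ∧ (((g k : ℕ) : ℝ) + 1) / n < a + ρ := by
  have hk : ∀ k : Fin (⌈ρ * n⌉₊ - 1), ((⌊a * n⌋₊ + k : ℕ) : ℝ) + 1 < (a + ρ) * n := fun k => by
    have h1 : ((k : ℕ) + 1 : ℕ) < ⌈ρ * n⌉₊ := by omega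
    rw [Nat.lt_ceil] at h1
    have h2 := Nat.floor_le (show (0 : ℝ) ≤ a * n by positivity)
    push_cast at h1 ⊢
    linarith
  have hlt : ∀ k : Fin (⌈ρ * n⌉₊ - 1), ⌊a * n⌋₊ + (k : ℕ) < n := fun k => by
    have h1 : (a + ρ) * n ≤ n := mul_le_of_le_one_left (Nat.cast_nonneg n) haρ
    have h2 : ((⌊a * n⌋₊ + k : ℕ) : ℝ) < n := by linarith [hk k]
    exact_mod_cast h2
  refine ⟨fun k => ⟨⌊a * n⌋₊ + k, hlt k⟩, fun k l h => ?_, fun k => ?_⟩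
  · ext
    simpa using h
  · have hn : (0 : ℝ) < n := by exact_mod_cast (Nat.zero_le _).trans_lt (hlt k)
    refine ⟨?_, (div_lt_iff₀ hn).2 (hk k)⟩
    rw [lt_div_iff₀ hn]
    refine (Nat.lt_floor_add_one (a * n)).trans_le ?_
    push_cast
    linarith [Nat.cast_nonneg (α := ℝ) (k : ℕ)]

/-- An almost everywhere continuous graphon that does not vanish is bounded below on a box around
some continuity point, and the box contains a positive proportion of the pairs of grid points. -/
theorem exists_quadratic_bound_of_deterministic {Ω : Type*}
    {W : unitInterval → unitInterval → ℝ} (hW : IsGraphon W) (hWpos : 0 < kernelNormOne W)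
    (hcont : AEContinuous W) {X : ∀ n : ℕ, Fin n → Ω → unitInterval}
    (hX : ∀ n, IsDeterministicLatent (X n)) :
    ∃ δ > 0, ∀ ω, ∀ᶠ n : ℕ in atTop,
      δ * (n : ℝ) ^ 2 ≤ ∑ p : VertexPair n, W (X n p.1.1 ω) (X n p.1.2 ω) := by
  obtain ⟨z, hz, hzpos⟩ : ∃ z : unitInterval × unitInterval,
      ContinuousAt (Function.uncurry W) z ∧ 0 < Function.uncurry W z := by
    by_contra! hcon
    refine hWpos.ne' (kernelNormOne_eq_zero_of_ae ?_)
    filter_upwards [hcont] with z hz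
    exact le_antisymm (hcon z hz) (hW.mem_Icc z.1 z.2).1
  set c := Function.uncurry W z / 2 with hc
  have hcpos : 0 < c := half_pos hzpos
  obtain ⟨r, hr, hball⟩ := Metric.eventually_nhds_iff.1
    (hz.eventually (lt_mem_nhds (half_lt_self hzpos)))
  -- the two coordinate intervals get the same length, hence equally many grid points
  set ρ := min r 1 with hρ
  have hρpos : 0 < ρ := lt_min hr one_pos
  obtain ⟨a, ha0, ha1, ha⟩ := exists_interval_near z.1 (min_le_right r 1)
  obtain ⟨b, hb0, hb1, hb⟩ := exists_interval_near z.2 (min_le_right r 1)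
  refine ⟨c * ρ ^ 2 / 8, by positivity, fun ω => ?_⟩
  filter_upwards [eventually_ge_atTop ⌈4 / ρ⌉₊] with n hn
  have hn' : 4 ≤ ρ * n := by
    have := Nat.ceil_le.1 hn
    rw [div_le_iff₀ hρpos] at this
    linarith
  obtain ⟨K, hK⟩ : ∃ K, ⌈ρ * n⌉₊ - 1 = K := ⟨_, rfl⟩
  have hgrida := exists_injective_grid n ha0 ha1
  have hgridb := exists_injective_grid n hb0 hb1
  rw [hK] at hgrida hgridb
  obtain ⟨ga, hga, hga'⟩ := hgrida
  obtain ⟨gb, hgb, hgb'⟩ := hgridb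
  have hblock := sum_block_le_two_mul_sum_vertexPair
    (f := fun i j => W (X n i ω) (X n j ω)) (fun i j => hW.symm _ _)
    (fun i j => (hW.mem_Icc _ _).1) hga hgb
  have hlow : ∀ k l, c ≤ W (X n (ga k) ω) (X n (gb l) ω) := fun k l => by
    refine (hball (y := (X n (ga k) ω, X n (gb l) ω)) ?_).le
    rw [Prod.dist_eq, max_lt_iff, Subtype.dist_eq, Subtype.dist_eq, Real.dist_eq, Real.dist_eq,
      hX, hX]
    exact ⟨(ha _ (hga' k).1 (hga' k).2).trans_le (min_le_left r 1),
      (hb _ (hgb' l).1 (hgb' l).2).trans_le (min_le_left r 1)⟩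
  have hKcast : ρ * n - 1 ≤ (K : ℝ) := by
    have h1 : 1 ≤ ⌈ρ * n⌉₊ := Nat.one_le_ceil_iff.2 (by linarith)
    rw [← hK, Nat.cast_sub h1]
    push_cast
    linarith [Nat.le_ceil (ρ * n)]
  -- each row of the block meets the diagonal at most once
  have hrow : ∀ k, c * (K - 1) ≤
      ∑ l, (if ga k = gb l then 0 else W (X n (ga k) ω) (X n (gb l) ω)) := fun k => by
    have h1 : ∑ l : Fin K, (c - if ga k = gb l then c else 0) ≤
        ∑ l, (if ga k = gb l then 0 else W (X n (ga k) ω) (X n (gb l) ω)) := by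
      refine Finset.sum_le_sum fun l _ => ?_
      split_ifs
      · simp
      · simpa using hlow k l
    have h2 : ∑ l : Fin K, (if ga k = gb l then c else 0) ≤ c := by
      have := sum_comp_le_sum_of_injective hgb (f := fun j => if ga k = j then c else 0)
        fun j => by split_ifs; exacts [hcpos.le, le_rfl]
      simpa using this
    rw [Finset.sum_sub_distrib] at h1
    simp only [Finset.sum_const, Finset.card_univ, Fintype.card_fin, nsmul_eq_mul] at h1
    linarith
  have hsum : K * (c * (K - 1)) ≤
      2 * ∑ p : VertexPair n, W (X n p.1.1 ω) (X n p.1.2 ω) := by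
    refine le_trans ?_ hblock
    have := Finset.sum_le_sum fun k (_ : k ∈ (Finset.univ : Finset (Fin K))) => hrow k
    simpa using this
  have h1 : ρ * n / 2 ≤ K := by linarith
  have h2 : ρ * n / 2 ≤ K - 1 := by linarith
  have h3 : (ρ * n / 2) * (ρ * n / 2) ≤ K * (K - 1 : ℝ) :=
    mul_le_mul h1 h2 (by linarith) (by linarith)
  nlinarith [mul_le_mul_of_nonneg_left h3 hcpos.le]

/-! ### Density of the latent positions: order statistics -/

lemma exp_neg_le_one_sub_half {v : ℝ} (h0 : 0 ≤ v) (h1 : v ≤ 1) : Real.exp (-v) ≤ 1 - v / 2 := by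
  rw [Real.exp_neg, inv_le_comm₀ (Real.exp_pos v) (by linarith)]
  refine le_trans ?_ (Real.add_one_le_exp v)
  rw [inv_le_comm₀ (by linarith) (by linarith), ← one_div, div_le_iff₀ (by linarith)]
  nlinarith

/-- An upper bound for the Laplace transform of a variable with values in the unit interval, in
terms of its mean. -/
lemma integral_exp_neg_le {α : Type*} [MeasurableSpace α] {ν : Measure α} [IsProbabilityMeasure ν]
    {f : α → ℝ} (hf : Measurable f) (h01 : ∀ x, f x ∈ Set.Icc (0 : ℝ) 1) :
    ∫ x, Real.exp (-f x) ∂ν ≤ Real.exp (-(1 / 2 * ∫ x, f x ∂ν)) := by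
  have hint : Integrable f ν := Integrable.of_mem_Icc 0 1 hf.aemeasurable (ae_of_all _ h01)
  calc ∫ x, Real.exp (-f x) ∂ν ≤ ∫ x, (1 - f x / 2) ∂ν := by
        refine integral_mono_of_nonneg (ae_of_all _ fun x => (Real.exp_pos _).le)
          ((integrable_const 1).sub (hint.div_const 2)) (ae_of_all _ fun x =>
            exp_neg_le_one_sub_half (h01 x).1 (h01 x).2)
    _ = -(1 / 2 * ∫ x, f x ∂ν) + 1 := by
        rw [integral_sub (integrable_const 1) (hint.div_const 2), integral_div]
        simp
        ring
    _ ≤ _ := Real.add_one_le_exp _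

/-- The Laplace transform of the edge density between two independent samples of size `m`,
estimated by integrating out first one sample and then the other. -/
lemma integral_exp_neg_bipartite_le {W : unitInterval → unitInterval → ℝ}
    (hW : Measurable (Function.uncurry W)) (h01 : ∀ x y, W x y ∈ Set.Icc (0 : ℝ) 1)
    {m : ℕ} (hm : 1 ≤ m) :
    ∫ z : (Fin m → unitInterval) × (Fin m → unitInterval),
        Real.exp (-((∑ a, ∑ b, W (z.1 a) (z.2 b)) / m)) ≤
      Real.exp (-((∫ z, Function.uncurry W z) / 4 * m)) := by
  have hm' : (0 : ℝ) < m := by exact_mod_cast hm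
  have hWint : Integrable (Function.uncurry W)
      ((volume : Measure unitInterval).prod (volume : Measure unitInterval)) :=
    Integrable.of_mem_Icc 0 1 hW.aemeasurable (ae_of_all _ fun z => h01 z.1 z.2)
  have hWx : ∀ x, Measurable (W x) := fun x => hW.comp measurable_prodMk_left
  have hd : Measurable (kernelDegree W) :=
    (hW.stronglyMeasurable.integral_prod_right).measurable
  have hd01 : ∀ x, kernelDegree W x ∈ Set.Icc (0 : ℝ) 1 := fun x => by
    refine ⟨integral_nonneg fun y => (h01 x y).1, ?_⟩
    have := integral_mono_of_nonneg (μ := (volume : Measure unitInterval))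
      (ae_of_all _ fun y => (h01 x y).1) (integrable_const (1 : ℝ))
      (ae_of_all _ fun y => (h01 x y).2)
    simpa [kernelDegree] using this
  have hF : Measurable fun z : (Fin m → unitInterval) × (Fin m → unitInterval) =>
      Real.exp (-((∑ a, ∑ b, W (z.1 a) (z.2 b)) / m)) := by
    have : ∀ a b, Measurable fun z : (Fin m → unitInterval) × (Fin m → unitInterval) =>
        W (z.1 a) (z.2 b) := fun a b =>
      show Measurable (Function.uncurry W ∘
          fun z : (Fin m → unitInterval) × (Fin m → unitInterval) => (z.1 a, z.2 b)) from
        hW.comp (((measurable_pi_apply a).comp measurable_fst).prodMk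
          ((measurable_pi_apply b).comp measurable_snd))
    fun_prop
  have hFint : Integrable (fun z : (Fin m → unitInterval) × (Fin m → unitInterval) =>
      Real.exp (-((∑ a, ∑ b, W (z.1 a) (z.2 b)) / m))) (volume.prod volume) := by
    refine Integrable.of_mem_Icc 0 1 hF.aemeasurable (ae_of_all _ fun z =>
      ⟨(Real.exp_pos _).le, Real.exp_le_one_iff.2 (neg_nonpos.2 ?_)⟩)
    exact div_nonneg (Finset.sum_nonneg fun a _ => Finset.sum_nonneg fun b _ => (h01 _ _).1) hm'.le
  rw [Measure.volume_eq_prod, integral_prod _ hFint]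
  have hinner : ∀ u : Fin m → unitInterval,
      ∫ v : Fin m → unitInterval, Real.exp (-((∑ a, ∑ b, W (u a) (v b)) / m)) ≤
        ∏ a, Real.exp (-(kernelDegree W (u a) / 2)) := fun u => by
    -- for fixed `u` the exponential factorizes over the points of the second sample
    set V : unitInterval → ℝ := fun y => (∑ a, W (u a) y) / m with hV
    have hVm : Measurable V := by
      have := fun a => hWx (u a)
      fun_prop
    have hV01 : ∀ y, V y ∈ Set.Icc (0 : ℝ) 1 := fun y => by
      refine ⟨div_nonneg (Finset.sum_nonneg fun a _ => (h01 _ _).1) hm'.le, ?_⟩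
      rw [div_le_one hm']
      have := Finset.sum_le_sum fun a (_ : a ∈ (Finset.univ : Finset (Fin m))) => (h01 (u a) y).2
      simpa using this
    have hprod : ∀ v : Fin m → unitInterval,
        Real.exp (-((∑ a, ∑ b, W (u a) (v b)) / m)) = ∏ b, Real.exp (-V (v b)) := fun v => by
      rw [← Real.exp_sum, Finset.sum_neg_distrib, ← Finset.sum_div, Finset.sum_comm]
    simp_rw [hprod]
    rw [integral_fintype_prod_volume_eq_pow fun y => Real.exp (-V y), ← Real.exp_sum]
    refine (pow_le_pow_left₀ (integral_nonneg fun y => (Real.exp_pos _).le)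
      (integral_exp_neg_le hVm hV01) _).trans_eq ?_
    rw [← Real.exp_nat_mul]
    congr 1
    have : ∫ y, V y = (∑ a, kernelDegree W (u a)) / m := by
      rw [hV, integral_div, integral_finsetSum]
      · rfl
      · exact fun a _ => Integrable.of_mem_Icc 0 1 (hWx _).aemeasurable
          (ae_of_all _ fun y => h01 _ y)
    rw [this, Finset.sum_neg_distrib, ← Finset.sum_div, Fintype.card_fin]
    field_simp
  calc _ ≤ ∫ u : Fin m → unitInterval, ∏ a, Real.exp (-(kernelDegree W (u a) / 2)) := by
        refine integral_mono_of_nonneg (ae_of_all _ fun u =>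
          integral_nonneg fun v => (Real.exp_pos _).le) ?_ (ae_of_all _ hinner)
        have : ∀ a : Fin m, Measurable fun u : Fin m → unitInterval => kernelDegree W (u a) :=
          fun a => hd.comp (measurable_pi_apply a)
        refine Integrable.of_mem_Icc 0 1
          (Finset.measurable_fun_prod _ fun a _ => ((this a).div_const 2).neg.exp).aemeasurable
          (ae_of_all _ fun u =>
          ⟨Finset.prod_nonneg fun a _ => (Real.exp_pos _).le,
            Finset.prod_le_one (fun a _ => (Real.exp_pos _).le) fun a _ =>
              Real.exp_le_one_iff.2 ?_⟩)
        linarith [(hd01 (u a)).1]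
    _ = (∫ x, Real.exp (-(kernelDegree W x / 2))) ^ m := by
        rw [integral_fintype_prod_volume_eq_pow fun x => Real.exp (-(kernelDegree W x / 2)),
          Fintype.card_fin]
    _ ≤ Real.exp (-(1 / 2 * ∫ x, kernelDegree W x / 2)) ^ m := by
        refine pow_le_pow_left₀ (integral_nonneg fun y => (Real.exp_pos _).le)
          (integral_exp_neg_le (hd.div_const 2) fun x => ?_) _
        constructor <;> linarith [(hd01 x).1, (hd01 x).2]
    _ = _ := by
        rw [← Real.exp_nat_mul, integral_div]
        have : ∫ x, kernelDegree W x = ∫ z, Function.uncurry W z := by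
          rw [Measure.volume_eq_prod, integral_prod _ hWint]
          rfl
        rw [this]
        congr 1
        ring

/-- A graphon agrees almost everywhere with a Borel function with values in the unit interval. -/
lemma IsGraphon.exists_measurable_ae_eq {W : unitInterval → unitInterval → ℝ} (hW : IsGraphon W) :
    ∃ V : unitInterval → unitInterval → ℝ, Measurable (Function.uncurry V) ∧
      (∀ x y, V x y ∈ Set.Icc (0 : ℝ) 1) ∧ Function.uncurry W =ᵐ[volume] Function.uncurry V := by
  have hae : AEMeasurable (Function.uncurry W)
      (volume : Measure (unitInterval × unitInterval)) := hW.measurable.aemeasurable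
  refine ⟨fun x y => max 0 (min 1 (hae.mk _ (x, y))), ?_, fun x y =>
    ⟨le_max_left _ _, max_le zero_le_one (min_le_left _ _)⟩, ?_⟩
  · exact measurable_const.max (measurable_const.min hae.measurable_mk)
  · filter_upwards [hae.ae_eq_mk] with z hz
    obtain ⟨h0, h1⟩ := hW.mem_Icc z.1 z.2
    change Function.uncurry W z = max 0 (min 1 (hae.mk _ z))
    rw [← hz]
    change W z.1 z.2 = max 0 (min 1 (W z.1 z.2))
    rw [min_eq_right h1, max_eq_right h0]

lemma kernelNormOne_eq_integral {W V : unitInterval → unitInterval → ℝ}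
    (hV : Measurable (Function.uncurry V)) (h01 : ∀ x y, V x y ∈ Set.Icc (0 : ℝ) 1)
    (hWV : Function.uncurry W =ᵐ[volume] Function.uncurry V) :
    kernelNormOne W = ∫ z, Function.uncurry V z := by
  rw [kernelNormOne, eLpNorm_congr_ae hWV, eLpNorm_one_eq_lintegral_enorm,
    ← integral_norm_eq_lintegral_enorm hV.aestronglyMeasurable]
  exact integral_congr_ae (ae_of_all _ fun z => Real.norm_of_nonneg (h01 z.1 z.2).1)

/-- Two disjoint subsamples of an independent uniform sample are independent uniform samples. -/
lemma measurePreserving_subsamples {Ω : Type*} [MeasurableSpace Ω] {μ : Measure Ω}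
    [IsProbabilityMeasure μ] {n m : ℕ} {U : Fin n → Ω → unitInterval}
    (hU : ∀ i, Measurable (U i)) (hind : iIndepFun U μ)
    (hlaw : ∀ i, μ.map (U i) = (volume : Measure unitInterval)) {ga gb : Fin m → Fin n}
    (ha : ga.Injective) (hb : gb.Injective) (hab : ∀ a b, ga a ≠ gb b) :
    MeasurePreserving (fun ω => ((fun a => U (ga a) ω, fun b => U (gb b) ω) :
      (Fin m → unitInterval) × (Fin m → unitInterval))) μ volume := by
  have hg : (Sum.elim ga gb).Injective := ha.sumElim hb hab
  have h1 : MeasurePreserving (fun ω (k : Fin m ⊕ Fin m) => U (Sum.elim ga gb k) ω) μ volume := by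
    refine ⟨measurable_pi_lambda _ fun k => hU _, ?_⟩
    rw [(hind.precomp hg).map_fun_eq_pi_map fun k => (hU _).aemeasurable]
    simp_rw [hlaw]
    rfl
  exact (volume_measurePreserving_sumPiEquivProdPi fun _ : Fin m ⊕ Fin m => unitInterval).comp h1

/-- Two distinct sample points do not distinguish kernels that agree almost everywhere. -/
lemma ae_eq_comp_pair {Ω : Type*} [MeasurableSpace Ω] {μ : Measure Ω}
    [IsProbabilityMeasure μ] {n : ℕ} {U : Fin n → Ω → unitInterval}
    (hU : ∀ i, Measurable (U i)) (hind : iIndepFun U μ)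
    (hlaw : ∀ i, μ.map (U i) = (volume : Measure unitInterval))
    {W V : unitInterval → unitInterval → ℝ}
    (hWV : Function.uncurry W =ᵐ[volume] Function.uncurry V) {i j : Fin n} (hij : i ≠ j) :
    ∀ᵐ ω ∂μ, W (U i ω) (U j ω) = V (U i ω) (U j ω) := by
  have hmap : μ.map (fun ω => (U i ω, U j ω)) = volume := by
    rw [(indepFun_iff_map_prod_eq_prod_map_map (hU i).aemeasurable (hU j).aemeasurable).1
      (hind.indepFun hij), hlaw, hlaw]
    rfl
  rw [← hmap] at hWV
  exact ae_of_ae_map ((hU i).prodMk (hU j)).aemeasurable hWV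

/-- The lower tail of the sum of the graphon over the pairs joining two disjoint subsamples. The
mean is `kernelNormOne W * m ^ 2`. -/
lemma measureReal_bipartite_le {Ω : Type*} [MeasurableSpace Ω] {μ : Measure Ω}
    [IsProbabilityMeasure μ] {W : unitInterval → unitInterval → ℝ} (hW : IsGraphon W)
    {n m : ℕ} (hm : 1 ≤ m) {U : Fin n → Ω → unitInterval}
    (hU : ∀ i, Measurable (U i)) (hind : iIndepFun U μ)
    (hlaw : ∀ i, μ.map (U i) = (volume : Measure unitInterval)) {ga gb : Fin m → Fin n}
    (ha : ga.Injective) (hb : gb.Injective) (hab : ∀ a b, ga a ≠ gb b) :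
    μ.real {ω | ∑ a, ∑ b, W (U (ga a) ω) (U (gb b) ω) ≤ kernelNormOne W / 8 * m ^ 2} ≤
      Real.exp (-(kernelNormOne W / 8 * m)) := by
  obtain ⟨V, hV, h01, hWV⟩ := hW.exists_measurable_ae_eq
  have hm' : (0 : ℝ) < m := by exact_mod_cast hm
  set w := kernelNormOne W with hw
  have hmp := measurePreserving_subsamples hU hind hlaw ha hb hab
  have hVm : ∀ a b, Measurable fun ω => V (U (ga a) ω) (U (gb b) ω) := fun a b =>
    hV.comp ((hU (ga a)).prodMk (hU (gb b)))
  have hF : Measurable fun z : (Fin m → unitInterval) × (Fin m → unitInterval) =>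
      Real.exp (-((∑ a, ∑ b, V (z.1 a) (z.2 b)) / m)) := by
    have : ∀ a b, Measurable fun z : (Fin m → unitInterval) × (Fin m → unitInterval) =>
        V (z.1 a) (z.2 b) := fun a b =>
      show Measurable (Function.uncurry V ∘
          fun z : (Fin m → unitInterval) × (Fin m → unitInterval) => (z.1 a, z.2 b)) from
        hV.comp (((measurable_pi_apply a).comp measurable_fst).prodMk
          ((measurable_pi_apply b).comp measurable_snd))
    fun_prop
  have hlaplace := integral_exp_neg_bipartite_le hV h01 hm
  rw [← kernelNormOne_eq_integral hV h01 hWV, ← hw, ← hmp.map_eq,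
    integral_map hmp.measurable.aemeasurable hF.aestronglyMeasurable] at hlaplace
  have hint : Integrable (fun ω =>
      Real.exp (-((∑ a, ∑ b, V (U (ga a) ω) (U (gb b) ω)) / m))) μ := by
    refine Integrable.of_mem_Icc 0 1 (hF.comp hmp.measurable).aemeasurable (ae_of_all _ fun ω =>
      ⟨(Real.exp_pos _).le, Real.exp_le_one_iff.2 (neg_nonpos.2 ?_)⟩)
    exact div_nonneg (Finset.sum_nonneg fun a _ => Finset.sum_nonneg fun b _ => (h01 _ _).1) hm'.le
  have markov := mul_meas_ge_le_integral_of_nonneg (ae_of_all _ fun ω =>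
    (Real.exp_pos (-((∑ a, ∑ b, V (U (ga a) ω) (U (gb b) ω)) / m))).le) hint
      (Real.exp (-(w / 8 * m)))
  have hsub : μ.real {ω | ∑ a, ∑ b, W (U (ga a) ω) (U (gb b) ω) ≤ w / 8 * m ^ 2} ≤
      μ.real {ω | Real.exp (-(w / 8 * m)) ≤
        Real.exp (-((∑ a, ∑ b, V (U (ga a) ω) (U (gb b) ω)) / m))} := by
    refine ENNReal.toReal_mono (measure_ne_top _ _) (measure_mono_ae ?_)
    filter_upwards [ae_all_iff.2 fun a => ae_all_iff.2 fun b =>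
      ae_eq_comp_pair hU hind hlaw hWV (hab a b)] with ω hω h
    change ∑ a, ∑ b, W (U (ga a) ω) (U (gb b) ω) ≤ w / 8 * m ^ 2 at h
    change Real.exp (-(w / 8 * m)) ≤ Real.exp (-((∑ a, ∑ b, V (U (ga a) ω) (U (gb b) ω)) / m))
    simp_rw [hω] at h
    rw [Real.exp_le_exp, neg_le_neg_iff, div_le_iff₀ hm']
    linarith [sq (m : ℝ)]
  refine hsub.trans ?_
  have h2 := markov.trans hlaplace
  rw [show -(w / 4 * m) = -(w / 8 * m) + -(w / 8 * m) by ring, Real.exp_add] at h2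
  exact le_of_mul_le_mul_left h2 (Real.exp_pos _)

/-- The Borel-Cantelli lemma with an eventual summable bound on real-valued probabilities. -/
lemma ae_eventually_notMem_of_measureReal_le {Ω : Type*} [MeasurableSpace Ω] {μ : Measure Ω}
    [IsFiniteMeasure μ] {B : ℕ → Set Ω} {b : ℕ → ℝ} (hb : Summable b)
    (hB : ∀ᶠ n in atTop, μ.real (B n) ≤ b n) : ∀ᵐ ω ∂μ, ∀ᶠ n in atTop, ω ∉ B n := by
  have hsummable : Summable fun n => μ.real (B n) :=
    hb.of_norm_bounded_eventually_nat (hB.mono fun n hn => by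
      rwa [Real.norm_of_nonneg measureReal_nonneg])
  refine ae_eventually_notMem ?_
  have h1 : ∀ n, μ (B n) = ENNReal.ofReal (μ.real (B n)) := fun n => (ofReal_measureReal).symm
  simp_rw [h1]
  exact hsummable.tsum_ofReal_ne_top

/-- For order statistics of an independent uniform sample, the sum of the graphon over the pairs of
latent positions is almost surely of quadratic order. Sorting only permutes the pairs, and the
pairs with one vertex in each half of the sample already contribute enough. -/
theorem exists_quadratic_bound_of_stochastic {Ω : Type*} [MeasurableSpace Ω] {μ : Measure Ω}
    [IsProbabilityMeasure μ] {W : unitInterval → unitInterval → ℝ} (hW : IsGraphon W)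
    (hWpos : 0 < kernelNormOne W) {X : ∀ n : ℕ, Fin n → Ω → unitInterval}
    (hX : ∀ n, IsStochasticLatent μ (X n)) :
    ∃ δ > 0, ∀ᵐ ω ∂μ, ∀ᶠ n : ℕ in atTop,
      δ * (n : ℝ) ^ 2 ≤ ∑ p : VertexPair n, W (X n p.1.1 ω) (X n p.1.2 ω) := by
  set w := kernelNormOne W with hw
  choose U hU hind hlaw hXU using hX
  have hlt : ∀ n : ℕ, ∀ a : Fin (n / 2), (a : ℕ) < n ∧ n / 2 + (a : ℕ) < n := fun n a => by
    have := a.isLt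
    omega
  let ga : ∀ n : ℕ, Fin (n / 2) → Fin n := fun n a => ⟨a, (hlt n a).1⟩
  let gb : ∀ n : ℕ, Fin (n / 2) → Fin n := fun n a => ⟨n / 2 + a, (hlt n a).2⟩
  have ha : ∀ n, (ga n).Injective := fun n a b h => by
    ext
    simpa [ga] using h
  have hb : ∀ n, (gb n).Injective := fun n a b h => by
    ext
    simpa [gb] using h
  have hab : ∀ n a b, ga n a ≠ gb n b := fun n a b h => by
    have h1 : (a : ℕ) = n / 2 + b := congrArg Fin.val h
    have := a.isLt
    omega
  have hhalf : ∀ n : ℕ, ((n : ℝ) - 1) / 2 ≤ ((n / 2 : ℕ) : ℝ) := fun n => by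
    have : n ≤ 2 * (n / 2) + 1 := by omega
    have : (n : ℝ) ≤ 2 * ((n / 2 : ℕ) : ℝ) + 1 := by exact_mod_cast this
    linarith
  have hrare : ∀ᵐ ω ∂μ, ∀ᶠ n in atTop, ω ∉
      {ω | ∑ a, ∑ b, W (U n (ga n a) ω) (U n (gb n b) ω) ≤ w / 8 * ((n / 2 : ℕ) : ℝ) ^ 2} := by
    refine ae_eventually_notMem_of_measureReal_le ((summable_geometric_of_lt_one
      (Real.exp_pos (-(w / 16))).le (Real.exp_lt_one_iff.2 (by linarith))).mul_left
        (Real.exp (w / 16))) ?_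
    filter_upwards [eventually_ge_atTop 2] with n hn
    refine (measureReal_bipartite_le hW (by omega) (hU n) (hind n) (hlaw n) (ha n) (hb n)
      (hab n)).trans ?_
    rw [← Real.exp_nat_mul, ← Real.exp_add, Real.exp_le_exp]
    nlinarith [hhalf n]
  refine ⟨w / 144, by positivity, ?_⟩
  filter_upwards [hrare] with ω hω
  filter_upwards [hω, eventually_ge_atTop 3] with n hn h3
  have hn' : w / 8 * ((n / 2 : ℕ) : ℝ) ^ 2 <
      ∑ a, ∑ b, W (U n (ga n a) ω) (U n (gb n b) ω) := not_le.1 hn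
  have hsort : 2 * ∑ p : VertexPair n, W (X n p.1.1 ω) (X n p.1.2 ω) =
      2 * ∑ p : VertexPair n, W (U n p.1.1 ω) (U n p.1.2 ω) := by
    rw [← sum_offDiag_eq_two_mul_sum_vertexPair (f := fun i j => W (X n i ω) (X n j ω))
        fun i j => hW.symm _ _,
      ← sum_offDiag_eq_two_mul_sum_vertexPair (f := fun i j => W (U n i ω) (U n j ω))
        fun i j => hW.symm _ _]
    simp only [hXU, orderStatistics, Function.comp_apply]
    set σ := Tuple.sort fun k => U n k ω
    rw [← Equiv.sum_comp σ fun i => ∑ j, if i = j then 0 else W (U n i ω) (U n j ω)]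
    refine Finset.sum_congr rfl fun i _ => ?_
    rw [← Equiv.sum_comp σ fun j => if σ i = j then 0 else W (U n (σ i) ω) (U n j ω)]
    simp only [σ.injective.eq_iff]
  have hblock := sum_block_le_two_mul_sum_vertexPair
    (f := fun i j => W (U n i ω) (U n j ω)) (fun i j => hW.symm _ _)
    (fun i j => (hW.mem_Icc _ _).1) (ha n) (hb n)
  simp only [if_neg (hab n _ _)] at hblock
  have hthird : (n : ℝ) / 3 ≤ ((n / 2 : ℕ) : ℝ) := by
    have : (3 : ℝ) ≤ n := by exact_mod_cast h3
    linarith [hhalf n]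
  have hsq : ((n : ℝ) / 3) ^ 2 ≤ ((n / 2 : ℕ) : ℝ) ^ 2 := by gcongr
  nlinarith [mul_le_mul_of_nonneg_left hsq hWpos.le]

/-! ### Degrees and edges of the sampled graph -/

/-- The weights of a sampled graph, without the convention on the diagonal. -/
noncomputable def edgeWeight (W : unitInterval → unitInterval → ℝ) {n : ℕ}
    (x : Fin n → unitInterval) (h : Fin n → Fin n → Bool) (i j : Fin n) : ℝ :=
  (SignType.sign (W (x i) (x j)) : ℝ) * if h (min i j) (max i j) = true then 1 else 0

lemma average_normalizedDegree_sampledAdjacency {W : unitInterval → unitInterval → ℝ}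
    (hW : ∀ x y, W x y = W y x) {n : ℕ} (x : Fin n → unitInterval) (h : Fin n → Fin n → Bool) :
    (∑ i, normalizedDegree (sampledAdjacency W x h) i) / n =
      2 * (∑ p : VertexPair n, edgeWeight W x h p.1.1 p.1.2) / (n : ℝ) ^ 2 := by
  rw [← sum_offDiag_eq_two_mul_sum_vertexPair fun i j => by
    rw [edgeWeight, edgeWeight, hW, min_comm, max_comm]]
  simp only [normalizedDegree, ← Finset.sum_div]
  rw [div_div, ← sq]
  rfl

lemma edgeWeight_le {W : unitInterval → unitInterval → ℝ} {n : ℕ}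
    (x : Fin n → unitInterval) (h : Fin n → Fin n → Bool) (i j : Fin n) :
    edgeWeight W x h i j ≤ if h (min i j) (max i j) = true then 1 else 0 := by
  refine mul_le_of_le_one_left (by split_ifs <;> simp) ?_
  rcases lt_trichotomy (W (x i) (x j)) 0 with h | h | h
  · simp [sign_neg h]
  · simp [h]
  · simp [sign_pos h]

/-- The sign in the weight is `1` at every edge on which the graphon does not vanish. -/
lemma edgeWeight_eq {W : unitInterval → unitInterval → ℝ} (hW : ∀ x y, 0 ≤ W x y) {n : ℕ}
    (x : Fin n → unitInterval) (h : Fin n → Fin n → Bool) (p : VertexPair n)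
    (hp : h p.1.1 p.1.2 = true → W (x p.1.1) (x p.1.2) ≠ 0) :
    edgeWeight W x h p.1.1 p.1.2 = if h p.1.1 p.1.2 = true then 1 else 0 := by
  rw [edgeWeight, min_eq_left p.2.le, max_eq_right p.2.le]
  split_ifs with h1
  · rw [sign_pos ((hW _ _).lt_of_ne' (hp h1))]
    simp
  · simp

lemma edgeProb_mem_Icc {Ω : Type*} {W : unitInterval → unitInterval → ℝ} {ε : ℝ} {n : ℕ}
    {X : Fin n → Ω → unitInterval} (hW : IsGraphon W) (h0 : 0 < ε) (h1 : ε ≤ 1) (ω : Ω)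
    (p : VertexPair n) :
    edgeProb W ε X ω p ∈ Set.Icc (0 : ℝ) 1 := by
  obtain ⟨a, b⟩ := hW.mem_Icc (X p.1.1 ω) (X p.1.2 ω)
  rw [edgeProb, abs_of_nonneg a]
  exact ⟨mul_nonneg h0.le a, mul_le_one₀ h1 a b⟩

namespace IsEdgeSample

variable {Ω : Type*} [MeasurableSpace Ω] {μ : Measure Ω} [IsProbabilityMeasure μ]
  {W : unitInterval → unitInterval → ℝ} {ε : ℝ} {n : ℕ} {X : Fin n → Ω → unitInterval}
  {η : Fin n → Fin n → Ω → Bool}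

/-- The lower tail of the number of edges, from the Chernoff bound with all weights `-1`. -/
lemma measureReal_edges_le (h : IsEdgeSample μ W ε X η) (hW : IsGraphon W) (h0 : 0 < ε)
    (h1 : ε ≤ 1) (s : ℝ) :
    μ.real {ω | (∑ p : VertexPair n, if η p.1.1 p.1.2 ω = true then (1 : ℝ) else 0) ≤
      ε / 2 * (∑ p : VertexPair n, W (X p.1.1 ω) (X p.1.2 ω)) - s} ≤ Real.exp (-s) := by
  refine (measureReal_mono fun ω hω => ?_).trans
    (h.measureReal_le_exp (edgeProb_mem_Icc hW h0 h1) (fun _ => -1) s)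
  have hω' : (∑ p : VertexPair n, if η p.1.1 p.1.2 ω = true then (1 : ℝ) else 0) ≤
      ε / 2 * (∑ p : VertexPair n, W (X p.1.1 ω) (X p.1.2 ω)) - s := hω
  change s + ∑ p, (Real.exp (-1) - 1) * edgeProb W ε X ω p ≤
    ∑ p : VertexPair n, -1 * if η p.1.1 p.1.2 ω = true then 1 else 0
  have hr : ∀ p, edgeProb W ε X ω p = ε * W (X p.1.1 ω) (X p.1.2 ω) := fun p => by
    rw [edgeProb, abs_of_nonneg (hW.mem_Icc _ _).1]
  simp_rw [hr]
  rw [← Finset.mul_sum, ← Finset.mul_sum, ← Finset.mul_sum]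
  have hexp := exp_neg_le_one_sub_half zero_le_one le_rfl
  have hT : 0 ≤ ε * ∑ p : VertexPair n, W (X p.1.1 ω) (X p.1.2 ω) :=
    mul_nonneg h0.le (Finset.sum_nonneg fun p _ => (hW.mem_Icc _ _).1)
  nlinarith

/-- The upper tail of a degree, from the Chernoff bound with weight `1` on the pairs containing
the vertex. -/
lemma measureReal_degree_le (h : IsEdgeSample μ W ε X η) (hW : IsGraphon W) (h0 : 0 < ε)
    (h1 : ε ≤ 1) (i : Fin n) (s : ℝ) :
    μ.real {ω | s + 2 * (ε * n) ≤
      ∑ j, if i = j then 0 else if η (min i j) (max i j) ω = true then (1 : ℝ) else 0} ≤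
        Real.exp (-s) := by
  refine (measureReal_mono fun ω hω => ?_).trans
    (h.measureReal_le_exp (edgeProb_mem_Icc hW h0 h1)
      (fun p => (if p.1.1 = i then 1 else 0) + if p.1.2 = i then 1 else 0) s)
  have hω' : s + 2 * (ε * n) ≤
      ∑ j, if i = j then 0 else if η (min i j) (max i j) ω = true then (1 : ℝ) else 0 := hω
  rw [← sum_incident_eq (g := fun i j => if η (min i j) (max i j) ω = true then (1 : ℝ) else 0)
    fun k l => by rw [min_comm, max_comm]] at hω'
  refine (add_le_add_right ?_ s).trans (hω'.trans_eq ?_)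
  · calc _ ≤ ∑ p : VertexPair n,
          ((if p.1.1 = i then 1 else 0) + if p.1.2 = i then 1 else 0) * (2 * ε) := by
          refine Finset.sum_le_sum fun p _ => ?_
          obtain ⟨hr0, -⟩ := edgeProb_mem_Icc (X := X) hW h0 h1 ω p
          have hr : edgeProb W ε X ω p ≤ ε := by
            obtain ⟨a, b⟩ := hW.mem_Icc (X p.1.1 ω) (X p.1.2 ω)
            rw [edgeProb, abs_of_nonneg a]
            exact mul_le_of_le_one_right h0.le b
          have hexp : Real.exp 1 - 1 ≤ 2 := by linarith [Real.exp_one_lt_d9]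
          by_cases hp1 : p.1.1 = i
          · have hp2 : p.1.2 ≠ i := fun hp2 => p.2.ne (hp1.trans hp2.symm)
            simp only [hp1, hp2, if_true, if_false, add_zero, one_mul]
            exact mul_le_mul hexp hr hr0 zero_le_two
          · by_cases hp2 : p.1.2 = i
            · simp only [hp1, hp2, if_true, if_false, zero_add, one_mul]
              exact mul_le_mul hexp hr hr0 zero_le_two
            · simp [hp1, hp2]
      _ = ∑ j, if i = j then 0 else 2 * ε :=
          sum_incident_eq (g := fun _ _ => 2 * ε) (fun _ _ => rfl) i
      _ ≤ ∑ _j : Fin n, 2 * ε := by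
          refine Finset.sum_le_sum fun j _ => ?_
          split_ifs <;> linarith
      _ = _ := by
          simp
          ring
  · refine Finset.sum_congr rfl fun p _ => ?_
    rw [min_eq_left p.2.le, max_eq_right p.2.le]

lemma measureReal_exists_degree_le (h : IsEdgeSample μ W ε X η) (hW : IsGraphon W) (h0 : 0 < ε)
    (h1 : ε ≤ 1) (s : ℝ) :
    μ.real {ω | ∃ i, s + 2 * (ε * n) ≤
      ∑ j, if i = j then 0 else if η (min i j) (max i j) ω = true then (1 : ℝ) else 0} ≤
        n * Real.exp (-s) := by
  rw [Set.ofPred_exists]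
  refine (measureReal_iUnion_fintype_le _).trans ?_
  refine (Finset.sum_le_sum fun i _ => h.measureReal_degree_le hW h0 h1 i s).trans ?_
  simp

end IsEdgeSample

/-! ### Almost sure asymptotics -/

lemma exp_neg_mul_log_natCast {n : ℕ} (hn : 1 ≤ n) (k : ℕ) :
    Real.exp (-(k * Real.log n)) = ((n : ℝ) ^ k)⁻¹ := by
  have : (0 : ℝ) < n := by exact_mod_cast hn
  rw [Real.exp_neg, Real.exp_nat_mul, Real.exp_log this]

lemma isTheta_one_of_eventually_mem_Icc {f : ℕ → ℝ} {c C : ℝ} (hc : 0 < c)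
    (hf : ∀ᶠ n in atTop, f n ∈ Set.Icc c C) : f =Θ[atTop] fun _ => (1 : ℝ) := by
  refine ⟨IsBigO.of_bound C (hf.mono fun n hn => ?_), IsBigO.of_bound c⁻¹ (hf.mono fun n hn => ?_)⟩
  · rw [norm_one, mul_one, Real.norm_of_nonneg (hc.le.trans hn.1)]
    exact hn.2
  · rw [norm_one, Real.norm_of_nonneg (hc.le.trans hn.1), inv_mul_eq_div, one_le_div hc]
    exact hn.1

theorem mainTheorem4 {Ω : Type*} [MeasurableSpace Ω] (μ : Measure Ω) [IsProbabilityMeasure μ]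
    (W : unitInterval → unitInterval → ℝ) (hW : IsGraphon W) (hWpos : 0 < kernelNormOne W)
    (ε : ℕ → ℝ) (hε : ∀ n, 1 ≤ n → 0 < ε n ∧ ε n ≤ 1)
    (hεω : (fun n : ℕ => Real.log n / n) =o[atTop] ε)
    (X : ∀ n : ℕ, Fin n → Ω → unitInterval)
    (hX : (AEContinuous W ∧ ∀ n, IsDeterministicLatent (X n)) ∨
      (∀ n, IsStochasticLatent μ (X n)))
    (η : ∀ n : ℕ, Fin n → Fin n → Ω → Bool)
    (hη : ∀ n, IsEdgeSample μ W (ε n) (X n) (η n))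
    (A : ∀ n : ℕ, Ω → Matrix (Fin n) (Fin n) ℝ)
    (hA : ∀ n ω, A n ω = sampledAdjacency W (fun i => X n i ω) (fun i j => η n i j ω)) :
    (∀ n, 1 ≤ n → ∀ ω,
      IsGreatest (Set.range (normalizedDegree (A n ω)))
        (funNormTop (kernelDegree (stepKernel (A n ω)))) ∧
      kernelNormOne (stepKernel (A n ω)) = (∑ i, normalizedDegree (A n ω) i) / n) ∧
    ∀ᵐ ω ∂μ,
      ((fun n => (ε n)⁻¹ * funNormTop (kernelDegree (stepKernel (A n ω))))
        =Θ[atTop] (fun _ => (1 : ℝ))) ∧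
      ((fun n => (ε n)⁻¹ * kernelNormOne (stepKernel (A n ω)))
        =Θ[atTop] (fun _ => (1 : ℝ))) := by
  have hA0 : ∀ n ω i j, 0 ≤ A n ω i j := fun n ω i j => by
    rw [hA]
    exact sampledAdjacency_nonneg (fun x y => (hW.mem_Icc x y).1) _ _ i j
  have hmax : ∀ n, 1 ≤ n → ∀ ω, IsGreatest (Set.range (normalizedDegree (A n ω)))
      (funNormTop (kernelDegree (stepKernel (A n ω)))) := fun n hn ω =>
    isGreatest_funNormTop_kernelDegree hn (hA0 n ω)
  have hone : ∀ n ω, kernelNormOne (stepKernel (A n ω)) =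
      (∑ i, normalizedDegree (A n ω) i) / n := fun n ω => kernelNormOne_stepKernel (hA0 n ω)
  refine ⟨fun n hn ω => ⟨hmax n hn ω, hone n ω⟩, ?_⟩
  obtain ⟨δ, hδ, hdense⟩ : ∃ δ > 0, ∀ᵐ ω ∂μ, ∀ᶠ n : ℕ in atTop,
      δ * (n : ℝ) ^ 2 ≤ ∑ p : VertexPair n, W (X n p.1.1 ω) (X n p.1.2 ω) := by
    rcases hX with ⟨hcont, hX⟩ | hX
    · obtain ⟨δ, hδ, h⟩ := exists_quadratic_bound_of_deterministic hW hWpos hcont hX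
      exact ⟨δ, hδ, ae_of_all _ h⟩
    · exact exists_quadratic_bound_of_stochastic hW hWpos hX
  have hsq : Summable fun n : ℕ => ((n : ℝ) ^ 2)⁻¹ := Real.summable_nat_pow_inv.2 one_lt_two
  have hlower : ∀ᵐ ω ∂μ, ∀ᶠ n : ℕ in atTop, ω ∉
      {ω | (∑ p : VertexPair n, if η n p.1.1 p.1.2 ω = true then (1 : ℝ) else 0) ≤
        ε n / 2 * (∑ p : VertexPair n, W (X n p.1.1 ω) (X n p.1.2 ω)) -
          (2 : ℕ) * Real.log n} := by
    refine ae_eventually_notMem_of_measureReal_le hsq ?_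
    filter_upwards [eventually_ge_atTop 1] with n hn
    refine ((hη n).measureReal_edges_le hW (hε n hn).1 (hε n hn).2 _).trans_eq ?_
    exact exp_neg_mul_log_natCast hn 2
  have hupper : ∀ᵐ ω ∂μ, ∀ᶠ n : ℕ in atTop, ω ∉
      {ω | ∃ i : Fin n, (3 : ℕ) * Real.log n + 2 * (ε n * n) ≤
        ∑ j, if i = j then 0 else
          if η n (min i j) (max i j) ω = true then (1 : ℝ) else 0} := by
    refine ae_eventually_notMem_of_measureReal_le hsq ?_
    filter_upwards [eventually_ge_atTop 1] with n hn
    refine ((hη n).measureReal_exists_degree_le hW (hε n hn).1 (hε n hn).2 _).trans_eq ?_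
    have hn' : (n : ℝ) ≠ 0 := by exact_mod_cast (by omega : n ≠ 0)
    rw [exp_neg_mul_log_natCast hn 3]
    field_simp
  have hedge : ∀ᵐ ω ∂μ, ∀ n, ∀ p : VertexPair n, η n p.1.1 p.1.2 ω = true →
      W (X n p.1.1 ω) (X n p.1.2 ω) ≠ 0 := ae_all_iff.2 fun n => (hη n).ae_ne_zero_of_edge
  have hlog : ∀ c : ℝ, 0 < c → ∀ᶠ n : ℕ in atTop, Real.log n ≤ c * (ε n * n) := fun c hc => by
    filter_upwards [hεω.bound hc, eventually_ge_atTop 1] with n hn h1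
    have hn' : (0 : ℝ) < n := by exact_mod_cast h1
    rw [Real.norm_of_nonneg (div_nonneg (Real.log_natCast_nonneg n) hn'.le),
      Real.norm_of_nonneg (hε n h1).1.le, div_le_iff₀ hn'] at hn
    linarith
  filter_upwards [hdense, hlower, hupper, hedge] with ω h1 h2 h3 h4
  have hbounds : ∀ᶠ n : ℕ in atTop,
      δ / 2 ≤ (ε n)⁻¹ * kernelNormOne (stepKernel (A n ω)) ∧
      (ε n)⁻¹ * kernelNormOne (stepKernel (A n ω)) ≤
        (ε n)⁻¹ * funNormTop (kernelDegree (stepKernel (A n ω))) ∧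
      (ε n)⁻¹ * funNormTop (kernelDegree (stepKernel (A n ω))) ≤ 5 := by
    filter_upwards [h1, h2, h3, hlog (δ / 8) (by positivity), hlog 1 one_pos,
      eventually_ge_atTop 1] with n h1 h2 h3 hlog1 hlog2 hn
    have hn' : (1 : ℝ) ≤ n := by exact_mod_cast hn
    have hn0 : (0 : ℝ) < n := by linarith
    have hεn := (hε n hn).1
    refine ⟨?_, mul_le_mul_of_nonneg_left ?_ (inv_nonneg.2 hεn.le), ?_⟩
    · rw [hone, hA, average_normalizedDegree_sampledAdjacency hW.symm,
        Finset.sum_congr rfl fun p _ =>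
          edgeWeight_eq (fun x y => (hW.mem_Icc x y).1) _ _ p (h4 n p)]
      have hN := not_le.1 h2
      push_cast at hN
      have hT := mul_le_mul_of_nonneg_left h1 (half_pos hεn).le
      have hlin : δ / 8 * (ε n * n) ≤ δ / 8 * (ε n * n) * n :=
        le_mul_of_one_le_right (by positivity) hn'
      rw [inv_mul_eq_div, le_div_iff₀ hεn, le_div_iff₀ (by positivity)]
      nlinarith
    · rw [hone, div_le_iff₀ hn0]
      have := Finset.sum_le_sum fun i (_ : i ∈ (Finset.univ : Finset (Fin n))) =>
        (hmax n hn ω).2 ⟨i, rfl⟩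
      simpa [mul_comm] using this
    · obtain ⟨i, hi⟩ := (hmax n hn ω).1
      rw [← hi, inv_mul_eq_div, div_le_iff₀ hεn, normalizedDegree, div_le_iff₀ hn0, hA]
      have hdeg := not_le.1 fun hle => h3 ⟨i, hle⟩
      push_cast at hdeg
      have hle : ∑ j, sampledAdjacency W (fun i => X n i ω) (fun i j => η n i j ω) i j ≤
          ∑ j, if i = j then 0 else
            if η n (min i j) (max i j) ω = true then (1 : ℝ) else 0 := by
        refine Finset.sum_le_sum fun j _ => ?_
        by_cases hij : i = j
        · simp [sampledAdjacency, hij]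
        · simp only [sampledAdjacency, if_neg hij]
          exact edgeWeight_le (W := W) (fun i => X n i ω) (fun i j => η n i j ω) i j
      linarith
  exact ⟨isTheta_one_of_eventually_mem_Icc (half_pos hδ)
      (hbounds.mono fun n hn => ⟨hn.1.trans hn.2.1, hn.2.2⟩),
    isTheta_one_of_eventually_mem_Icc (half_pos hδ)
      (hbounds.mono fun n hn => ⟨hn.1, hn.2.1.trans hn.2.2⟩)⟩
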